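/- Let $n\ge 1$. "Measure on $\mathbb R^n$" means finite signed Borel measure. For a measure $\mu$ on $\mathbb R^n$, $\mu$ is integrable if $\int\|x\|_2\,|\mu|(dx)<\infty$, and $\mu*\nu$ denotes the multiplicative convolution $(\mu*\nu)(A)=\int\mu(dx)\int\nu(dy)\,\mathbf 1_A(xy)$, where $xy$ is the componentwise product. For $E\subset[n]=\{1,\dots,n\}$ let $A_E=\{x\in\mathbb R^n: x_i\neq 0\Leftrightarrow i\in E\}$, let $R_E(\mu)(A)=\mu(A\cap A_E)$, let $P_E(\mu)$ be the image of $\mu$ under the orthogonal projection onto $\operatorname{span}\{e_i:i\in E\}$, and let $T_E(\mu)$ be the image of $\mu$ under the map changing the sign of the coordinates in $E$. Put $M_{\rm unc}(\mu)=2^{-n}\sum_{E\subset[n]}T_E(\mu)$. A measure $\mu$ is unconditional if $T_E(\mu)=\mu$ for all $E\subset[n]$; it is of order $E$ if $|\mu|(A_E)>0$ and $|\mu|(A_F)=0$ for all $F\ne E$; its degree is the largest $k$ such that $R_E(\mu)\ne0$ for some $E\subset[n]$ with $|E|=k$ (the zero measure has no degree). For $A\in\{A_{[n]},\mathbb R^n\}$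 let $\mathcal M^{\rm int}_{\rm unc}(A)$ be the set of integrable unconditional measures $\mu$ on $\mathbb R^n$ concentrated on $A$ (i.e. $\mu(B)=0$ for every Borel $B\subset\mathbb R^n\setminus A$). A measure $\nu$ is universal on a set $\mathcal A$ of measures if, for every $\mu\in\mathcal A$, $\nu*\mu=0$ implies $\mu=0$. Theorem (unconditional measures). Let $\nu$ be an integrable measure on $\mathbb R^n$. Then: (i) $\nu$ is universal on $\mathcal M^{\rm int}_{\rm unc}(A_{[n]})$ if and only if $M_{\rm unc}(\nu)$ has degree $n$. (ii) $\nu$ is universal on $\mathcal M^{\rm int}_{\rm unc}(\mathbb R^n)$ if and only if $R_EP_EM_{\rm unc}(\nu)\neq0$ for every $E\subset[n]$. (iii) If $\nu$ is of order $[n]$, then $\nu$ is universal on $\mathcal M^{\rm int}_{\rm unc}(\mathbb R^n)$ if and only if $\nu(\mathbb R^n)\neq0$. (iv) If $\nu$ is non-negative, then $\nu$ is universal on $\mathcal M^{\rm int}_{\rm unc}(\mathbb R^n)$ if and only if $\nu$ has degree $n$. -/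

import Mathlib

open MeasureTheory

namespace MultConv

noncomputable section

/-- Euclidean space `ℝⁿ`; the coordinates `1, …, n` are indexed by `Fin n`. -/
abbrev Rn (n : ℕ) : Type := EuclideanSpace ℝ (Fin n)

variable {n : ℕ}

/-- Componentwise product of two vectors. -/
def cmul (x y : Rn n) : Rn n := WithLp.toLp 2 (fun i => x i * y i)

/-- The orthogonal projection of `ℝⁿ` onto the span of the basis vectors `e i`, `i ∈ E`. -/
def coordProj (E : Finset (Fin n)) (x : Rn n) : Rn n :=
  WithLp.toLp 2 (fun i => if i ∈ E then x i else 0)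

/-- The multiple reflection changing the sign of the coordinates in `E`. -/
def reflect (E : Finset (Fin n)) (x : Rn n) : Rn n :=
  WithLp.toLp 2 (fun i => if i ∈ E then -x i else x i)

/-- `A_E`, the set of vectors whose non-zero coordinates are exactly those in `E`. -/
def stratum (E : Finset (Fin n)) : Set (Rn n) := {x | ∀ i, x i ≠ 0 ↔ i ∈ E}

theorem measurable_cmul : Measurable (fun p : Rn n × Rn n => cmul p.1 p.2) := by
  unfold cmul; fun_prop

theorem measurable_coordProj (E : Finset (Fin n)) : Measurable (coordProj E) := by
  refine (WithLp.measurable_toLp 2 (Fin n → ℝ)).comp (measurable_pi_lambda _ fun i => ?_)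
  by_cases h : i ∈ E <;> simp only [h, if_true, if_false] <;> fun_prop

theorem measurable_reflect (E : Finset (Fin n)) : Measurable (reflect E) := by
  refine (WithLp.measurable_toLp 2 (Fin n → ℝ)).comp (measurable_pi_lambda _ fun i => ?_)
  by_cases h : i ∈ E <;> simp only [h, if_true, if_false] <;> fun_prop

theorem measurableSet_stratum (E : Finset (Fin n)) : MeasurableSet (stratum E) := by
  have h : stratum E = ⋂ i, {x : Rn n | x i ≠ 0 ↔ i ∈ E} := by
    ext x; simp [stratum]
  rw [h]
  refine MeasurableSet.iInter fun i => ?_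
  have hm : MeasurableSet {x : Rn n | x i = 0} :=
    measurableSet_eq_fun (by fun_prop) measurable_const
  by_cases hi : i ∈ E
  · have h2 : {x : Rn n | x i ≠ 0 ↔ i ∈ E} = {x : Rn n | x i = 0}ᶜ := by ext x; simp [hi]
    rw [h2]; exact hm.compl
  · have h2 : {x : Rn n | x i ≠ 0 ↔ i ∈ E} = {x : Rn n | x i = 0} := by ext x; simp [hi]
    rw [h2]; exact hm

instance instIsFiniteMeasureVariation (μ : SignedMeasure (Rn n)) : IsFiniteMeasure μ.variation := by
  rw [← SignedMeasure.totalVariation_eq_variation, SignedMeasure.totalVariation]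
  infer_instance

/-- Multiplicative convolution of two finite signed measures: the image of the product measure
under componentwise multiplication. -/
def mconv (μ ν : SignedMeasure (Rn n)) : SignedMeasure (Rn n) :=
  (μ.prod ν (ContinuousLinearMap.lsmul ℝ ℝ)).map (fun p => cmul p.1 p.2)

/-- `(μ * ν)(A) = ∫ μ(dx) ∫ ν(dy) 1_A(xy)`. -/
theorem mconv_apply (μ ν : SignedMeasure (Rn n)) {A : Set (Rn n)} (hA : MeasurableSet A) :
    mconv μ ν A = ∫ᵛ x, (∫ᵛ y, A.indicator (fun _ => (1 : ℝ)) (cmul x y) ∂•ν) ∂•μ := by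
  rw [mconv, VectorMeasure.map_apply _ measurable_cmul hA,
    VectorMeasure.prod_apply_eq_integral (measurable_cmul hA)]
  have h : (ContinuousLinearMap.lsmul ℝ ℝ : ℝ →L[ℝ] ℝ →L[ℝ] ℝ).flip
      = ContinuousLinearMap.lsmul ℝ ℝ := by
    ext; simp
  rw [h]
  congr 1
  ext x
  have hx : MeasurableSet {y : Rn n | cmul x y ∈ A} :=
    (measurable_cmul.comp measurable_prodMk_left) hA
  have h2 : (fun y => A.indicator (fun _ => (1 : ℝ)) (cmul x y))
      = {y : Rn n | cmul x y ∈ A}.indicator (fun _ => (1 : ℝ)) := by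
    ext y; simp [Set.indicator]
  rw [h2, VectorMeasure.integral_indicator hx, VectorMeasure.integral_const,
    VectorMeasure.restrict_apply _ hx MeasurableSet.univ]
  simp
  rfl

/-- The marginal measure `P_E(μ)`: the image of `μ` under the orthogonal projection. -/
def marginal (E : Finset (Fin n)) (μ : SignedMeasure (Rn n)) : SignedMeasure (Rn n) :=
  μ.map (coordProj E)

/-- The component `R_E(μ) = μ_E`, that is `A ↦ μ (A ∩ A_E)`. -/
def component (E : Finset (Fin n)) (μ : SignedMeasure (Rn n)) : SignedMeasure (Rn n) :=
  μ.restrict (stratum E)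

/-- `M_unc(μ) = 2⁻ⁿ ∑_E T_E(μ)`. -/
def uncMean (μ : SignedMeasure (Rn n)) : SignedMeasure (Rn n) :=
  ((2 : ℝ) ^ n)⁻¹ • ∑ E : Finset (Fin n), μ.map (reflect E)

/-- `∫ ‖x‖₂ |μ|(dx) < ∞`. -/
def IsIntegrable (μ : SignedMeasure (Rn n)) : Prop :=
  Integrable (fun x : Rn n => ‖x‖) μ.totalVariation

/-- `μ` is concentrated on `A`: it vanishes on every Borel set disjoint from `A`. -/
def ConcentratedOn (μ : SignedMeasure (Rn n)) (A : Set (Rn n)) : Prop :=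
  ∀ B : Set (Rn n), MeasurableSet B → B ⊆ Aᶜ → μ B = 0

/-- `μ` is invariant under all multiple reflections. -/
def IsUnconditional (μ : SignedMeasure (Rn n)) : Prop :=
  ∀ E : Finset (Fin n), μ.map (reflect E) = μ

/-- The integrable unconditional finite signed measures concentrated on `A`. -/
def intUnc (A : Set (Rn n)) : Set (SignedMeasure (Rn n)) :=
  {μ | ConcentratedOn μ A ∧ IsIntegrable μ ∧ IsUnconditional μ}

/-- `μ` is of order `E`. -/
def IsOfOrder (μ : SignedMeasure (Rn n)) (E : Finset (Fin n)) : Prop :=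
  0 < μ.totalVariation (stratum E) ∧
    ∀ F : Finset (Fin n), F ≠ E → μ.totalVariation (stratum F) = 0

/-- `μ` has degree `k`: `k` is the largest cardinality of an `E` with `μ_E ≠ 0`
(the zero measure has no degree). -/
def HasDegree (μ : SignedMeasure (Rn n)) (k : ℕ) : Prop :=
  IsGreatest {m : ℕ | ∃ E : Finset (Fin n), E.card = m ∧ component E μ ≠ 0} k

/-- `ν` is universal on `𝒜`. -/
def IsUniversalOn (ν : SignedMeasure (Rn n)) (𝒜 : Set (SignedMeasure (Rn n))) : Prop :=
  ∀ μ ∈ 𝒜, mconv ν μ = 0 → μ = 0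

end

end MultConv

/-! Everything reduces to one stratum at a time: `R_E P_E M_unc(ν)` decides what convolution with
`ν` detects of `R_E P_E μ`. Sufficiency uses the Mellin transform `∫ ∏_{i∈E} |x_i|^{s_i} dσ` for
small positive exponents. It is multiplicative under `mconv` and real-analytic along lines, so if `ν
* μ = 0` and the transform of `ν` is not identically zero, that of `μ` vanishes
(`mellin_eq_zero_of_mul`). The transform ignores signs and the set where a coordinate in `E` is
zero, so its vanishing means exactly that `R_E P_E M_unc` vanishes
(`component_marginal_uncMean_eq_zero` is the direction used). An unconditional `μ` is its own
average, and descending induction on `|E|` recovers `μ = 0` from `R_E P_E μ = 0` for all `E`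
(`eq_zero_of_component_marginal`). Necessity uses a test measure: if `R_E P_E M_unc(ν) = 0`, then
`ν` annihilates the nonzero unconditional measure `cornerMeasure E`, because a factor `δ₁ - δ₂`
convolved with mass at `0` gives zero (`mconv_cornerMeasure_eq_zero`). The last two criteria follow
by evaluating on the reflection-invariant sets `offAxes E`. -/

namespace MultConv
noncomputable section
variable {n : ℕ}

/-! ### Strata, marginals and unconditional averages -/

/-- The set of vectors none of whose coordinates in `E` vanish. -/
def offAxes (E : Finset (Fin n)) : Set (Rn n) := {x | ∀ i ∈ E, x i ≠ 0}

theorem mem_stratum {E : Finset (Fin n)} {x : Rn n} : x ∈ stratum E ↔ ∀ i, x i ≠ 0 ↔ i ∈ E :=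
  Iff.rfl

@[simp] theorem cmul_apply (x y : Rn n) (i : Fin n) : cmul x y i = x i * y i := rfl

@[simp] theorem coordProj_apply (E : Finset (Fin n)) (x : Rn n) (i : Fin n) :
    coordProj E x i = if i ∈ E then x i else 0 := rfl

@[simp] theorem reflect_apply (E : Finset (Fin n)) (x : Rn n) (i : Fin n) :
    reflect E x i = if i ∈ E then -x i else x i := rfl

theorem coordProj_preimage_stratum (E : Finset (Fin n)) :
    coordProj E ⁻¹' stratum E = offAxes E := by
  ext x
  simp only [Set.mem_preimage, mem_stratum, coordProj_apply, offAxes, Set.mem_ofPred_eq]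
  exact forall_congr' fun i => by by_cases h : i ∈ E <;> simp [h]

theorem measurableSet_offAxes (E : Finset (Fin n)) : MeasurableSet (offAxes E) := by
  rw [← coordProj_preimage_stratum]
  exact measurable_coordProj E (measurableSet_stratum E)

theorem reflect_preimage_offAxes (E F : Finset (Fin n)) :
    reflect F ⁻¹' offAxes E = offAxes E := by
  ext x
  simp only [Set.mem_preimage, offAxes, reflect_apply, Set.mem_ofPred_eq]
  exact forall₂_congr fun i _ => by by_cases h : i ∈ F <;> simp [h]

theorem reflect_preimage_stratum (E F : Finset (Fin n)) :
    reflect F ⁻¹' stratum E = stratum E := by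
  ext x
  simp only [Set.mem_preimage, mem_stratum, reflect_apply]
  exact forall_congr' fun i => by by_cases h : i ∈ F <;> simp [h]

theorem reflect_reflect (E F : Finset (Fin n)) (x : Rn n) :
    reflect E (reflect F x) = reflect (symmDiff E F) x := by
  ext i
  by_cases hE : i ∈ E <;> by_cases hF : i ∈ F <;> simp [hE, hF, Finset.mem_symmDiff]

theorem coordProj_univ : coordProj (Finset.univ : Finset (Fin n)) = id := by
  ext x i; simp

theorem marginal_univ (μ : SignedMeasure (Rn n)) : marginal Finset.univ μ = μ := by
  rw [marginal, coordProj_univ, VectorMeasure.map_id]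

/-- A finite measurable partition decomposes the values of a signed measure. -/
theorem apply_eq_sum_inter {α ι : Type*} [MeasurableSpace α] [Fintype ι] (σ : SignedMeasure α)
    {S : ι → Set α} (hS : ∀ i, MeasurableSet (S i)) (hd : Pairwise (Function.onFun Disjoint S))
    (hu : ∀ x, ∃ i, x ∈ S i) {B : Set α} (hB : MeasurableSet B) :
    σ B = ∑ i, σ (B ∩ S i) := by
  rw [← VectorMeasure.of_biUnion_finset]
  · congr 1
    ext x
    simpa using fun _ => hu x
  · exact fun i _ j _ hij => (hd hij).mono Set.inter_subset_right Set.inter_subset_right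
  · exact fun i _ => hB.inter (hS i)

theorem pairwise_disjoint_stratum :
    Pairwise (Function.onFun Disjoint (stratum (n := n))) := by
  intro E F hEF
  refine Set.disjoint_left.2 fun x hE hF => hEF ?_
  ext i
  exact (hE i).symm.trans (hF i)

theorem exists_mem_stratum (x : Rn n) : ∃ E, x ∈ stratum E :=
  ⟨Finset.univ.filter fun i => x i ≠ 0, fun i => by simp⟩

theorem apply_eq_sum_stratum (σ : SignedMeasure (Rn n)) {B : Set (Rn n)} (hB : MeasurableSet B) :
    σ B = ∑ E, σ (B ∩ stratum E) :=
  apply_eq_sum_inter σ measurableSet_stratum pairwise_disjoint_stratum exists_mem_stratum hB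

theorem component_apply (E : Finset (Fin n)) (σ : SignedMeasure (Rn n)) {B : Set (Rn n)}
    (hB : MeasurableSet B) : component E σ B = σ (B ∩ stratum E) :=
  VectorMeasure.restrict_apply _ (measurableSet_stratum E) hB

theorem marginal_apply (E : Finset (Fin n)) (σ : SignedMeasure (Rn n)) {B : Set (Rn n)}
    (hB : MeasurableSet B) : marginal E σ B = σ (coordProj E ⁻¹' B) :=
  VectorMeasure.map_apply _ (measurable_coordProj E) hB

theorem component_eq_zero_iff (E : Finset (Fin n)) (σ : SignedMeasure (Rn n)) :
    component E σ = 0 ↔ ∀ B, MeasurableSet B → σ (B ∩ stratum E) = 0 := by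
  constructor
  · intro h B hB
    rw [← component_apply E σ hB, h]; rfl
  · intro h
    ext B hB
    rw [component_apply E σ hB, h B hB]; rfl

theorem component_marginal_eq_zero_iff (E : Finset (Fin n)) (σ : SignedMeasure (Rn n)) :
    component E (marginal E σ) = 0 ↔
      ∀ B, MeasurableSet B → σ (coordProj E ⁻¹' (B ∩ stratum E)) = 0 := by
  rw [component_eq_zero_iff]
  exact forall₂_congr fun B hB => by rw [marginal_apply E σ (hB.inter (measurableSet_stratum E))]

theorem sum_coe {α ι : Type*} [MeasurableSpace α] (s : Finset ι) (f : ι → SignedMeasure α)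
    (B : Set α) : (∑ i ∈ s, f i) B = ∑ i ∈ s, f i B := by
  induction s using Finset.cons_induction with
  | empty => simp
  | cons a s ha ih => simp [Finset.sum_cons, ih]

theorem uncMean_apply (σ : SignedMeasure (Rn n)) {B : Set (Rn n)} (hB : MeasurableSet B) :
    uncMean σ B = ((2 : ℝ) ^ n)⁻¹ * ∑ E, σ (reflect E ⁻¹' B) := by
  rw [uncMean, smul_apply, sum_coe, smul_eq_mul]
  congr 1
  exact Finset.sum_congr rfl fun E _ => VectorMeasure.map_apply _ (measurable_reflect E) hB

theorem uncMean_apply_of_invariant (σ : SignedMeasure (Rn n)) {B : Set (Rn n)}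
    (hB : MeasurableSet B) (h : ∀ E, reflect E ⁻¹' B = B) : uncMean σ B = σ B := by
  rw [uncMean_apply σ hB]
  simp [h]

theorem IsUnconditional.uncMean_eq {σ : SignedMeasure (Rn n)} (h : IsUnconditional σ) :
    uncMean σ = σ := by
  ext B hB
  have h2 : ∀ E, σ (reflect E ⁻¹' B) = σ B := fun E => by
    rw [← VectorMeasure.map_apply _ (measurable_reflect E) hB, h E]
  rw [uncMean_apply σ hB]
  simp [h2]

/-! ### Reduction to absolute values -/

/-- The vector of absolute values. -/
def absVec (x : Rn n) : Rn n := WithLp.toLp 2 fun i => |x i|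

@[simp] theorem absVec_apply (x : Rn n) (i : Fin n) : absVec x i = |x i| := rfl

theorem measurable_absVec : Measurable (absVec (n := n)) := by
  refine (WithLp.measurable_toLp 2 (Fin n → ℝ)).comp (measurable_pi_lambda _ fun i => ?_)
  have : Measurable fun x : Rn n => x i := by fun_prop
  exact measurable_norm.comp this

/-- The set of vectors whose negative coordinates are exactly those in `G`. -/
def orthant (G : Finset (Fin n)) : Set (Rn n) := {x | ∀ i, x i < 0 ↔ i ∈ G}

theorem measurableSet_orthant (G : Finset (Fin n)) : MeasurableSet (orthant G) := by
  have h : orthant G = ⋂ i, {x : Rn n | x i < 0 ↔ i ∈ G} := by ext x; simp [orthant]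
  rw [h]
  refine MeasurableSet.iInter fun i => ?_
  have hm : MeasurableSet {x : Rn n | x i < 0} := measurableSet_lt (by fun_prop) measurable_const
  by_cases hi : i ∈ G
  · simpa [hi] using hm
  · simpa [hi, Set.compl_ofPred] using hm.compl

theorem reflect_absVec {G : Finset (Fin n)} {x : Rn n} (hx : x ∈ orthant G) :
    reflect G (absVec x) = x := by
  ext i
  by_cases h : i ∈ G
  · simp [h, abs_of_neg ((hx i).2 h)]
  · have := not_lt.1 (fun h' => h ((hx i).1 h'))
    simp [h, abs_of_nonneg this]

/-- Unconditional averaging only depends on the image under the absolute value map. -/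
theorem sum_reflect_eq_sum_reflect_absVec (σ : SignedMeasure (Rn n)) {B : Set (Rn n)}
    (hB : MeasurableSet B) :
    ∑ F, σ (reflect F ⁻¹' B) = ∑ F, σ (absVec ⁻¹' (reflect F ⁻¹' B)) := by
  have hd : Pairwise (Function.onFun Disjoint (orthant (n := n))) := fun E F hEF =>
    Set.disjoint_left.2 fun x hE hF => hEF (by ext i; exact (hE i).symm.trans (hF i))
  have hu : ∀ x : Rn n, ∃ E, x ∈ orthant E := fun x =>
    ⟨Finset.univ.filter fun i => x i < 0, fun i => by simp⟩
  have h1 : ∀ F, σ (reflect F ⁻¹' B) = ∑ G, σ (reflect F ⁻¹' B ∩ orthant G) := fun F =>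
    apply_eq_sum_inter σ measurableSet_orthant hd hu (measurable_reflect F hB)
  have h2 : ∀ F, σ (absVec ⁻¹' (reflect F ⁻¹' B)) =
      ∑ G, σ (absVec ⁻¹' (reflect F ⁻¹' B) ∩ orthant G) := fun F =>
    apply_eq_sum_inter σ measurableSet_orthant hd hu (measurable_absVec (measurable_reflect F hB))
  simp_rw [h1, h2]
  rw [Finset.sum_comm, Finset.sum_comm (f := fun F G => σ (absVec ⁻¹' (reflect F ⁻¹' B) ∩ _))]
  refine Finset.sum_congr rfl fun G _ => ?_
  -- On the orthant `G`, `x` is the `G`-reflection of its absolute value vector, so replacing `F` by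
  -- its symmetric difference with `G` matches the two sums term by term.
  refine Fintype.sum_equiv (symmDiff_left_involutive G).toPerm _ _ fun F => ?_
  rw [Function.Involutive.coe_toPerm]
  congr 1
  ext x
  refine and_congr_left fun hx => ?_
  simp only [Set.mem_preimage]
  rw [← reflect_reflect, reflect_absVec hx]

/-! ### Recovery of a measure from its marginal strata -/

/-- A signed measure all of whose marginal strata vanish is zero. -/
theorem eq_zero_of_component_marginal {μ : SignedMeasure (Rn n)}
    (h : ∀ E, component E (marginal E μ) = 0) : μ = 0 := by
  -- Descending induction on `|E|`. The preimage under `coordProj E` of a subset of `stratum E`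
  -- meets only the strata `F ⊇ E`; those with `F ≠ E` are null by induction, and `F = E`
  -- contributes the component itself.
  have key : ∀ k (E : Finset (Fin n)), n - E.card = k → component E μ = 0 := by
    intro k
    induction k using Nat.strong_induction_on with
    | _ k ih =>
    intro E hE
    rw [component_eq_zero_iff]
    intro B hB
    have h0 := (component_marginal_eq_zero_iff E μ).1 (h E) B hB
    have hm := measurable_coordProj E (hB.inter (measurableSet_stratum E))
    rw [apply_eq_sum_stratum μ hm, Finset.sum_eq_single E] at h0
    · rw [← h0]
      congr 1
      ext x
      refine and_congr_left fun hx => ?_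
      have hP : coordProj E x = x := by
        ext i
        by_cases hi : i ∈ E
        · simp [hi]
        · have := mt (hx i).1 hi
          simp only [ne_eq, not_not] at this
          simp [hi, this]
      simp [hP, hx]
    · intro F _ hFE
      by_cases hEF : E ⊆ F
      · have hc : E.card < F.card := Finset.card_lt_card (hEF.ssubset_of_ne hFE.symm)
        have hF : F.card ≤ n := by simpa using Finset.card_le_univ F
        exact (component_eq_zero_iff F μ).1 (ih (n - F.card) (by omega) F rfl) _ hm
      · obtain ⟨i, hiE, hiF⟩ := Finset.not_subset.1 hEF
        have : coordProj E ⁻¹' (B ∩ stratum E) ∩ stratum F = ∅ := by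
          ext x
          simp only [Set.mem_inter_iff, Set.mem_preimage, Set.mem_empty_iff_false, iff_false]
          rintro ⟨⟨-, h1⟩, h2⟩
          have h3 := (h1 i).2 hiE
          simp only [coordProj_apply, hiE, if_true] at h3
          exact hiF ((h2 i).1 h3)
        rw [this, VectorMeasure.empty]
    · simp
  ext B hB
  rw [apply_eq_sum_stratum μ hB]
  exact Finset.sum_eq_zero fun E _ => (component_eq_zero_iff E μ).1 (key _ E rfl) B hB

/-! ### Corner measures as test measures for necessity -/

/-- Convolution with a finite combination of point masses. -/
theorem mconv_sum_dirac {ι : Type*} (s : Finset ι) (c : ι → ℝ) (v : ι → Rn n)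
    (ν : SignedMeasure (Rn n)) {B : Set (Rn n)} (hB : MeasurableSet B) :
    mconv ν (∑ j ∈ s, VectorMeasure.dirac (v j) (c j)) B
      = ∑ j ∈ s, c j * ν ((fun x => cmul x (v j)) ⁻¹' B) := by
  have hp : ν.prod (∑ j ∈ s, VectorMeasure.dirac (v j) (c j)) (ContinuousLinearMap.lsmul ℝ ℝ)
      = ∑ j ∈ s, c j • ν.map (fun x => (x, v j)) := by
    refine VectorMeasure.prod_eq_of_forall_apply_prod fun A C hA hC => ?_
    simp only [sum_coe, smul_apply, ContinuousLinearMap.lsmul_apply, smul_eq_mul,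
      Finset.mul_sum]
    refine Finset.sum_congr rfl fun j _ => ?_
    rw [VectorMeasure.map_apply _ measurable_prodMk_right (hA.prod hC)]
    by_cases hj : v j ∈ C
    · rw [VectorMeasure.dirac_apply_of_mem hC hj, mul_comm]
      congr 2
      ext x; simp [hj]
    · rw [VectorMeasure.dirac_apply_of_notMem hj, mul_zero]
      have : (fun x => (x, v j)) ⁻¹' A ×ˢ C = ∅ := by ext x; simp [hj]
      rw [this, VectorMeasure.empty, mul_zero]
  rw [mconv, hp, VectorMeasure.map_apply _ measurable_cmul hB, sum_coe]
  refine Finset.sum_congr rfl fun j _ => ?_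
  rw [smul_apply, smul_eq_mul,
    VectorMeasure.map_apply _ measurable_prodMk_right (measurable_cmul hB)]
  rfl

/-- The vector supported on `E` with coordinate `2` on `S` and `1` on the rest of `E`. -/
def cornerVec (E S : Finset (Fin n)) : Rn n :=
  WithLp.toLp 2 fun i => if i ∈ E then (if i ∈ S then 2 else 1) else 0

@[simp] theorem cornerVec_apply (E S : Finset (Fin n)) (i : Fin n) :
    cornerVec E S i = if i ∈ E then (if i ∈ S then 2 else 1) else 0 := rfl

/-- The unconditional average of `⨂_{i ∈ E} (δ₁ - δ₂) ⊗ ⨂_{i ∉ E} δ₀`. -/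
def cornerMeasure (E : Finset (Fin n)) : SignedMeasure (Rn n) :=
  ∑ p : Finset (Fin n) × Finset (Fin n) with p.2 ⊆ E,
    VectorMeasure.dirac (reflect p.1 (cornerVec E p.2)) (((2 : ℝ) ^ n)⁻¹ * (-1) ^ p.2.card)

theorem sum_prod_subset (E : Finset (Fin n)) (f : Finset (Fin n) → Finset (Fin n) → ℝ) :
    ∑ p : Finset (Fin n) × Finset (Fin n) with p.2 ⊆ E, f p.1 p.2
      = ∑ F, ∑ S ∈ E.powerset, f F S := by
  rw [← Finset.sum_product']
  refine Finset.sum_congr ?_ fun _ _ => rfl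
  ext p; simp

theorem map_dirac_apply (f : Rn n → Rn n) (hf : Measurable f) (x : Rn n) (c : ℝ) :
    (VectorMeasure.dirac x c).map f = VectorMeasure.dirac (f x) c := by
  ext B hB
  rw [VectorMeasure.map_apply _ hf hB]
  by_cases h : f x ∈ B
  · rw [VectorMeasure.dirac_apply_of_mem hB h, VectorMeasure.dirac_apply_of_mem (hf hB) h]
  · rw [VectorMeasure.dirac_apply_of_notMem h, VectorMeasure.dirac_apply_of_notMem]
    exact h

theorem cornerMeasure_apply_eq_zero (E : Finset (Fin n)) {B : Set (Rn n)}
    (h : ∀ F S, S ⊆ E → reflect F (cornerVec E S) ∉ B) : cornerMeasure E B = 0 := by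
  rw [cornerMeasure, sum_coe]
  refine Finset.sum_eq_zero fun p hp => VectorMeasure.dirac_apply_of_notMem (h _ _ ?_)
  simpa using hp

theorem isUnconditional_cornerMeasure (E : Finset (Fin n)) :
    IsUnconditional (cornerMeasure E) := by
  intro F
  ext B hB
  rw [VectorMeasure.map_apply _ (measurable_reflect F) hB, cornerMeasure, sum_coe, sum_coe]
  have := sum_prod_subset E fun G S => VectorMeasure.dirac (reflect G (cornerVec E S))
    (((2 : ℝ) ^ n)⁻¹ * (-1) ^ S.card) B
  rw [this]
  have := sum_prod_subset E fun G S => VectorMeasure.dirac (reflect G (cornerVec E S))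
    (((2 : ℝ) ^ n)⁻¹ * (-1) ^ S.card) (reflect F ⁻¹' B)
  rw [this]
  refine Fintype.sum_equiv (symmDiff_right_involutive F).toPerm _ _ fun G => ?_
  rw [Function.Involutive.coe_toPerm]
  refine Finset.sum_congr rfl fun S _ => ?_
  rw [← reflect_reflect, ← map_dirac_apply _ (measurable_reflect F),
    VectorMeasure.map_apply _ (measurable_reflect F) hB]

theorem cornerMeasure_ne_zero (E : Finset (Fin n)) : cornerMeasure E ≠ 0 := by
  intro h0
  -- Modulus `1` on `E` selects the atoms with `S = ∅`, which all have weight `2⁻ⁿ` and positive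
  -- sign, so nothing cancels.
  set Q : Set (Rn n) := {x | ∀ i ∈ E, |x i| = 1} with hQdef
  have hQ : MeasurableSet Q := by
    have : Q = ⋂ i ∈ E, {x : Rn n | |x i| = 1} := by ext x; simp [Q]
    rw [this]
    refine MeasurableSet.biInter E.countable_toSet fun i _ => ?_
    have hm : Measurable fun x : Rn n => |x i| := by
      have : Measurable fun x : Rn n => x i := by fun_prop
      exact measurable_norm.comp this
    exact measurableSet_eq_fun hm measurable_const
  have h1 : cornerMeasure E Q = 1 := by
    have := sum_prod_subset E fun G S => VectorMeasure.dirac (reflect G (cornerVec E S))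
      (((2 : ℝ) ^ n)⁻¹ * (-1) ^ S.card) Q
    rw [cornerMeasure, sum_coe, this]
    have h2 : ∀ F, ∑ S ∈ E.powerset, VectorMeasure.dirac (reflect F (cornerVec E S))
        (((2 : ℝ) ^ n)⁻¹ * (-1) ^ S.card) Q = ((2 : ℝ) ^ n)⁻¹ := by
      intro F
      rw [Finset.sum_eq_single ∅]
      · rw [VectorMeasure.dirac_apply_of_mem hQ]
        · simp
        · intro i hi
          by_cases h : i ∈ F <;> simp [h, hi]
      · intro S hS hne
        refine VectorMeasure.dirac_apply_of_notMem fun hmem => ?_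
        obtain ⟨i, hi⟩ := Finset.nonempty_iff_ne_empty.2 hne
        have hiE := Finset.mem_powerset.1 hS hi
        have := hmem i hiE
        by_cases h : i ∈ F <;> norm_num [h, hi, hiE] at this
      · simp
    simp [h2]
  rw [h0] at h1
  simp at h1

/-- A Hahn set splits `C` into two pieces on which the total variation is `σ` or `-σ`. -/
theorem totalVariation_eq_zero {α : Type*} [MeasurableSpace α] (σ : SignedMeasure α) {C : Set α}
    (hC : MeasurableSet C) (h : ∀ B, MeasurableSet B → B ⊆ C → σ B = 0) :
    σ.totalVariation C = 0 := by
  obtain ⟨i, hi, h1, h2, hp, hq⟩ := σ.toJordanDecomposition_spec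
  rw [SignedMeasure.totalVariation, Measure.add_apply, hp, hq,
    SignedMeasure.toMeasureOfZeroLE_apply _ _ hi hC,
    SignedMeasure.toMeasureOfLEZero_apply _ _ hi.compl hC]
  have e1 := h (i ∩ C) (hi.inter hC) Set.inter_subset_right
  have e2 := h (iᶜ ∩ C) (hi.compl.inter hC) Set.inter_subset_right
  simp [e1, e2]

theorem isIntegrable_of_bounded {σ : SignedMeasure (Rn n)} {R : ℝ}
    (h : ∀ B, MeasurableSet B → B ⊆ {x | R < ‖x‖} → σ B = 0) : IsIntegrable σ := by
  have hC : MeasurableSet {x : Rn n | R < ‖x‖} :=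
    measurableSet_lt measurable_const measurable_norm
  have h0 := totalVariation_eq_zero σ hC h
  have hf : IsFiniteMeasure σ.totalVariation := by
    rw [SignedMeasure.totalVariation]; infer_instance
  refine Integrable.of_bound (C := R) measurable_norm.aestronglyMeasurable ?_
  rw [ae_iff]
  simpa using h0

theorem isIntegrable_cornerMeasure (E : Finset (Fin n)) : IsIntegrable (cornerMeasure E) := by
  -- The sum of the norms of all atoms is a crude bound for each of them.
  refine isIntegrable_of_bounded (R := ∑ p : Finset (Fin n) × Finset (Fin n),
    ‖reflect p.1 (cornerVec E p.2)‖) fun B _ hB =>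
      cornerMeasure_apply_eq_zero E fun F S _ hmem => ?_
  have h1 := hB hmem
  have h2 := Finset.single_le_sum (f := fun p : Finset (Fin n) × Finset (Fin n) =>
    ‖reflect p.1 (cornerVec E p.2)‖) (fun p _ => norm_nonneg _) (Finset.mem_univ (F, S))
  exact absurd h2 (not_le.2 h1)

theorem concentratedOn_cornerMeasure (E : Finset (Fin n)) :
    ConcentratedOn (cornerMeasure E) (stratum E) := by
  intro B _ hBE
  refine cornerMeasure_apply_eq_zero E fun F S _ hmem => hBE hmem fun i => ?_
  by_cases hF : i ∈ F <;> by_cases hi : i ∈ E <;> by_cases hS : i ∈ S <;> simp [hF, hi, hS]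

/-- In a componentwise product a reflection can be moved from one factor to the other, where
averaging produces `uncMean ν`; as the corner vectors vanish off `E`, only the projection to `E`
matters. -/
theorem mconv_cornerMeasure_apply (ν : SignedMeasure (Rn n)) (E : Finset (Fin n))
    {B : Set (Rn n)} (hB : MeasurableSet B) :
    mconv ν (cornerMeasure E) B = ∑ S ∈ E.powerset,
      (-1) ^ S.card * marginal E (uncMean ν) ((fun x => cmul x (cornerVec E S)) ⁻¹' B) := by
  have hm : ∀ v : Rn n, Measurable fun x => cmul x v := fun v =>
    measurable_cmul.comp measurable_prodMk_right
  have := sum_prod_subset E fun F S => (((2 : ℝ) ^ n)⁻¹ * (-1) ^ S.card) *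
    ν ((fun x => cmul x (reflect F (cornerVec E S))) ⁻¹' B)
  rw [cornerMeasure, mconv_sum_dirac _ _ _ _ hB, this, Finset.sum_comm]
  refine Finset.sum_congr rfl fun S _ => ?_
  rw [marginal_apply E _ (hm _ hB), uncMean_apply ν (measurable_coordProj E (hm _ hB)),
    Finset.mul_sum, Finset.mul_sum]
  refine Finset.sum_congr rfl fun F _ => ?_
  have : (fun x => cmul x (reflect F (cornerVec E S))) ⁻¹' B
      = reflect F ⁻¹' (coordProj E ⁻¹' ((fun x => cmul x (cornerVec E S)) ⁻¹' B)) := by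
    ext x
    simp only [Set.mem_preimage]
    have : cmul x (reflect F (cornerVec E S))
        = cmul (coordProj E (reflect F x)) (cornerVec E S) := by
      ext i
      by_cases hF : i ∈ F <;> by_cases hi : i ∈ E <;> by_cases hS : i ∈ S <;> simp [hF, hi, hS]
    rw [this]
  rw [this]
  ring

theorem mconv_cornerMeasure_eq_zero {ν : SignedMeasure (Rn n)} {E : Finset (Fin n)}
    (h : component E (marginal E (uncMean ν)) = 0) : mconv ν (cornerMeasure E) = 0 := by
  have hm : ∀ v : Rn n, Measurable fun x => cmul x v := fun v =>
    measurable_cmul.comp measurable_prodMk_right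
  set ρ := marginal E (uncMean ν) with hρ
  ext B hB
  rw [mconv_cornerMeasure_apply ν E hB, ← hρ]
  have h1 : ∀ S, ρ ((fun x => cmul x (cornerVec E S)) ⁻¹' B)
      = ∑ G, ρ ((fun x => cmul x (cornerVec E S)) ⁻¹' B ∩ stratum G) := fun S =>
    apply_eq_sum_stratum ρ (hm _ hB)
  simp_rw [h1, Finset.mul_sum]
  rw [Finset.sum_comm]
  refine Finset.sum_eq_zero fun G _ => ?_
  by_cases hGE : G = E
  · subst hGE
    exact Finset.sum_eq_zero fun S _ => by
      rw [(component_eq_zero_iff G ρ).1 h _ (hm _ hB), mul_zero]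
  by_cases hsub : E ⊆ G
  -- The marginal gives no mass to vectors with a nonzero coordinate outside `E`.
  · refine Finset.sum_eq_zero fun S _ => ?_
    obtain ⟨i, hiG, hiE⟩ := Finset.not_subset.1 fun h' => hGE (h'.antisymm hsub)
    rw [hρ, marginal_apply E _ ((hm _ hB).inter (measurableSet_stratum G))]
    have : coordProj E ⁻¹' ((fun x => cmul x (cornerVec E S)) ⁻¹' B ∩ stratum G) = ∅ := by
      ext x
      simp only [Set.mem_preimage, Set.mem_inter_iff, Set.mem_empty_iff_false, iff_false]
      rintro ⟨-, h2⟩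
      exact (h2 i).2 hiG (by simp [hiE])
    rw [this, VectorMeasure.empty, mul_zero]
  -- Here `x i = 0` on `stratum G`, so toggling `i` in `S` leaves the product unchanged and flips
  -- the sign: the terms cancel in pairs.
  · obtain ⟨i, hiE, hiG⟩ := Finset.not_subset.1 hsub
    refine Finset.sum_involution (fun S _ => symmDiff S {i}) ?_ ?_ ?_ ?_
    · intro S hS
      have hc : ((-1 : ℝ)) ^ (symmDiff S {i}).card = - (-1) ^ S.card := by
        by_cases hi : i ∈ S
        · have : symmDiff S {i} = S.erase i := by
            ext j; by_cases hj : j = i <;> simp [Finset.mem_symmDiff, hj, hi]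
          rw [this, ← Finset.card_erase_add_one hi, pow_succ]; simp
        · have : symmDiff S {i} = insert i S := by
            ext j; by_cases hj : j = i <;> simp [Finset.mem_symmDiff, hj, hi]
          rw [this, Finset.card_insert_of_notMem hi, pow_succ]; simp
      have hset : (fun x => cmul x (cornerVec E (symmDiff S {i}))) ⁻¹' B ∩ stratum G
          = (fun x => cmul x (cornerVec E S)) ⁻¹' B ∩ stratum G := by
        ext x
        refine and_congr_left fun hx => ?_
        have hxi : x i = 0 := by
          by_contra hne
          exact hiG ((hx i).1 hne)
        have : cmul x (cornerVec E (symmDiff S {i})) = cmul x (cornerVec E S) := by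
          ext j
          by_cases hj : j = i
          · subst hj; simp [hxi]
          · simp [Finset.mem_symmDiff, hj]
        simp only [Set.mem_preimage, this]
      rw [hc, hset]; ring
    · intro S _ _ heq
      have := (Finset.ext_iff.1 heq i)
      simp [Finset.mem_symmDiff] at this
    · intro S hS
      rw [Finset.mem_powerset] at hS ⊢
      intro j hj
      rcases Finset.mem_symmDiff.1 hj with ⟨h', -⟩ | ⟨h', -⟩
      · exact hS h'
      · rw [Finset.mem_singleton.1 h']; exact hiE
    · intro S _
      exact symmDiff_symmDiff_cancel_right _ _

/-! ### Uniqueness from exponential moments -/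

open ProbabilityTheory in
/-- Two finite measures whose exponential moments in every direction are finite and agree near the
origin have the same image. -/
theorem map_eq_of_exp_moments {Ω : Type*} [MeasurableSpace Ω] {α β : Measure Ω} [IsFiniteMeasure α]
    [IsFiniteMeasure β] {φ : Ω → Rn n} (hφ : Measurable φ)
    (h : ∀ t : Rn n, ∃ U ∈ nhds (0 : ℝ), ∀ r ∈ U,
      Integrable (fun ω => Real.exp (r * inner ℝ (φ ω) t)) α ∧
      Integrable (fun ω => Real.exp (r * inner ℝ (φ ω) t)) β ∧
      ∫ ω, Real.exp (r * inner ℝ (φ ω) t) ∂α = ∫ ω, Real.exp (r * inner ℝ (φ ω) t) ∂β) :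
    α.map φ = β.map φ := by
  refine Measure.ext_of_charFun (funext fun t => ?_)
  obtain ⟨U, hU, hUr⟩ := h t
  obtain ⟨ε, hε, hball⟩ := Metric.mem_nhds_iff.1 hU
  set X : Ω → ℝ := fun ω => inner ℝ (φ ω) t with hX
  have hα : Metric.ball 0 ε ⊆ integrableExpSet X α := fun r hr => (hUr r (hball hr)).1
  have hβ : Metric.ball 0 ε ⊆ integrableExpSet X β := fun r hr => (hUr r (hball hr)).2.1
  have hα' := Metric.isOpen_ball.subset_interior_iff.2 hα
  have hβ' := Metric.isOpen_ball.subset_interior_iff.2 hβ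
  have hsα : Complex.re ⁻¹' Metric.ball 0 ε ⊆ {z | z.re ∈ interior (integrableExpSet X α)} :=
    fun z hz => hα' hz
  have hsβ : Complex.re ⁻¹' Metric.ball 0 ε ⊆ {z | z.re ∈ interior (integrableExpSet X β)} :=
    fun z hz => hβ' hz
  have hconv : IsPreconnected (Complex.re ⁻¹' Metric.ball (0 : ℝ) ε) :=
    ((convex_ball (0 : ℝ) ε).linear_preimage Complex.reLm).isPreconnected
  -- Agreement on a real interval extends to the vertical strip around it by the identity theorem;
  -- the strip contains `I`, where the complex moment generating function is the characteristic
  -- function at `t`.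
  have heq : Set.EqOn (complexMGF X α) (complexMGF X β) (Complex.re ⁻¹' Metric.ball 0 ε) := by
    refine (analyticOnNhd_complexMGF.mono hsα).eqOn_of_preconnected_of_frequently_eq
      (analyticOnNhd_complexMGF.mono hsβ) hconv (z₀ := 0) (by simpa using hε) ?_
    have hev : ∀ᶠ r : ℝ in nhdsWithin 0 {0}ᶜ, complexMGF X α r = complexMGF X β r := by
      filter_upwards [nhdsWithin_le_nhds (Metric.ball_mem_nhds (0 : ℝ) hε)] with r hr
      rw [complexMGF_ofReal, complexMGF_ofReal]
      exact congrArg _ (hUr r (hball hr)).2.2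
    have htend : Filter.Tendsto (fun r : ℝ => (r : ℂ)) (nhdsWithin 0 {0}ᶜ)
        (nhdsWithin 0 {0}ᶜ) := by
      refine tendsto_nhdsWithin_iff.2 ⟨?_, ?_⟩
      · exact (Complex.continuous_ofReal.tendsto' 0 0 (by simp)).mono_left nhdsWithin_le_nhds
      · filter_upwards [self_mem_nhdsWithin] with r hr
        simpa using hr
    exact htend.frequently hev.frequently
  have h1 := heq (x := Complex.I) (by simpa using hε)
  rw [charFun_apply, charFun_apply, integral_map hφ.aemeasurable (by fun_prop),
    integral_map hφ.aemeasurable (by fun_prop)]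
  simpa [complexMGF, hX, mul_comm] using h1

/-! ### Power functions, tilted measures and analyticity -/

/-- The function `∏_{i ∈ E} |x i| ^ s i`. -/
def absPow (E : Finset (Fin n)) (s : Fin n → ℝ) (x : Rn n) : ℝ := ∏ i ∈ E, |x i| ^ s i

/-- The open simplex of exponents supported on `E`. -/
def expSimplex (E : Finset (Fin n)) : Set (Fin n → ℝ) :=
  {s | (∀ i ∈ E, 0 < s i) ∧ ∑ i ∈ E, s i < 1}

/-- The function `∑_{i ∈ E} d i * log |x i|`. -/
def logForm (E : Finset (Fin n)) (d : Fin n → ℝ) (x : Rn n) : ℝ :=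
  ∑ i ∈ E, d i * Real.log |x i|

theorem measurable_coord_abs (i : Fin n) : Measurable fun x : Rn n => |x i| := by
  have : Measurable fun x : Rn n => x i := by fun_prop
  exact measurable_norm.comp this

theorem measurable_absPow (E : Finset (Fin n)) (s : Fin n → ℝ) : Measurable (absPow E s) :=
  Finset.measurable_fun_prod _ fun i _ => (measurable_coord_abs i).pow_const _

theorem absPow_nonneg (E : Finset (Fin n)) (s : Fin n → ℝ) (x : Rn n) : 0 ≤ absPow E s x :=
  Finset.prod_nonneg fun _ _ => Real.rpow_nonneg (abs_nonneg _) _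

theorem absPow_cmul (E : Finset (Fin n)) (s : Fin n → ℝ) (x y : Rn n) :
    absPow E s (cmul x y) = absPow E s x * absPow E s y := by
  simp only [absPow, ← Finset.prod_mul_distrib, cmul_apply, abs_mul]
  exact Finset.prod_congr rfl fun i _ => Real.mul_rpow (abs_nonneg _) (abs_nonneg _)

/-- Total exponent below `1` gives at most linear growth, so a finite first moment suffices for
every exponent in the simplex. -/
theorem absPow_le {E : Finset (Fin n)} {s : Fin n → ℝ} (hs : s ∈ expSimplex E) (x : Rn n) :
    absPow E s x ≤ 1 + ‖x‖ := by
  have hM : 1 ≤ 1 + ‖x‖ := by linarith [norm_nonneg x]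
  calc absPow E s x ≤ ∏ i ∈ E, (1 + ‖x‖) ^ s i := by
        refine Finset.prod_le_prod (fun i _ => Real.rpow_nonneg (abs_nonneg _) _) fun i hi => ?_
        refine Real.rpow_le_rpow (abs_nonneg _) ?_ (hs.1 i hi).le
        have := PiLp.norm_apply_le x i
        rw [Real.norm_eq_abs] at this
        linarith
    _ = (1 + ‖x‖) ^ ∑ i ∈ E, s i := (Real.rpow_sum_of_pos (by linarith) _ _).symm
    _ ≤ (1 + ‖x‖) ^ (1 : ℝ) := Real.rpow_le_rpow_of_exponent_le hM hs.2.le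
    _ = 1 + ‖x‖ := Real.rpow_one _

theorem integrable_absPow {E : Finset (Fin n)} {s : Fin n → ℝ} (hs : s ∈ expSimplex E)
    {m : Measure (Rn n)} [IsFiniteMeasure m] (hm : Integrable (fun x : Rn n => ‖x‖) m) :
    Integrable (absPow E s) m := by
  refine ((integrable_const (1 : ℝ)).add hm).mono' (measurable_absPow E s).aestronglyMeasurable ?_
  refine Filter.Eventually.of_forall fun x => ?_
  rw [Real.norm_of_nonneg (absPow_nonneg E s x)]
  exact absPow_le hs x

theorem absPow_eq_zero {E : Finset (Fin n)} {s : Fin n → ℝ} (hs : s ∈ expSimplex E) {x : Rn n}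
    (hx : x ∉ offAxes E) : absPow E s x = 0 := by
  simp only [offAxes, Set.mem_ofPred_eq, not_forall, not_not] at hx
  obtain ⟨i, hi, h0⟩ := hx
  refine Finset.prod_eq_zero hi ?_
  rw [h0, abs_zero, Real.zero_rpow (hs.1 i hi).ne']

theorem absPow_eq_exp {E : Finset (Fin n)} (s : Fin n → ℝ) {x : Rn n} (hx : x ∈ offAxes E) :
    absPow E s x = Real.exp (logForm E s x) := by
  rw [logForm, Real.exp_sum]
  refine Finset.prod_congr rfl fun i hi => ?_
  rw [Real.rpow_def_of_pos (abs_pos.2 (hx i hi)), mul_comm]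

/-- Where some coordinate in `E` is zero, `Real.log 0 = 0` makes the exponential meaningless, but
positive exponents make both powers vanish. -/
theorem absPow_add_smul {E : Finset (Fin n)} {p d : Fin n → ℝ} {r : ℝ} (hp : p ∈ expSimplex E)
    (hr : p + r • d ∈ expSimplex E) (x : Rn n) :
    absPow E (p + r • d) x = absPow E p x * Real.exp (r * logForm E d x) := by
  by_cases hx : x ∈ offAxes E
  · rw [absPow_eq_exp _ hx, absPow_eq_exp _ hx, ← Real.exp_add]
    congr 1
    simp only [logForm, Finset.mul_sum, ← Finset.sum_add_distrib]
    exact Finset.sum_congr rfl fun i _ => by simp; ring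
  · rw [absPow_eq_zero hp hx, absPow_eq_zero hr hx, zero_mul]

/-- The measure with density `∏_{i ∈ E} |x i| ^ p i`. -/
def tilt (E : Finset (Fin n)) (p : Fin n → ℝ) (m : Measure (Rn n)) : Measure (Rn n) :=
  m.withDensity fun x => ENNReal.ofReal (absPow E p x)

theorem isFiniteMeasure_tilt {E : Finset (Fin n)} {p : Fin n → ℝ} (hp : p ∈ expSimplex E)
    {m : Measure (Rn n)} [IsFiniteMeasure m] (hm : Integrable (fun x : Rn n => ‖x‖) m) :
    IsFiniteMeasure (tilt E p m) :=
  isFiniteMeasure_withDensity_ofReal (integrable_absPow hp hm).2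

/-- Along a line through `p`, the Mellin integral becomes the moment generating function of `logForm
E d` under the tilted measure. -/
theorem integral_exp_tilt {E : Finset (Fin n)} {p d : Fin n → ℝ} {r : ℝ} (hp : p ∈ expSimplex E)
    (hr : p + r • d ∈ expSimplex E) (m : Measure (Rn n)) :
    ∫ x, Real.exp (r * logForm E d x) ∂(tilt E p m) = ∫ x, absPow E (p + r • d) x ∂m := by
  rw [tilt, integral_withDensity_eq_integral_toReal_smul
    (measurable_absPow E p).ennreal_ofReal (by simp)]
  refine integral_congr_ae (Filter.Eventually.of_forall fun x => ?_)
  simp only [ENNReal.toReal_ofReal (absPow_nonneg E p x), smul_eq_mul, absPow_add_smul hp hr]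

theorem integrable_exp_tilt {E : Finset (Fin n)} {p d : Fin n → ℝ} {r : ℝ} (hp : p ∈ expSimplex E)
    (hr : p + r • d ∈ expSimplex E) {m : Measure (Rn n)} [IsFiniteMeasure m]
    (hm : Integrable (fun x : Rn n => ‖x‖) m) :
    Integrable (fun x => Real.exp (r * logForm E d x)) (tilt E p m) := by
  rw [tilt, integrable_withDensity_iff_integrable_smul'
    (measurable_absPow E p).ennreal_ofReal (by simp)]
  refine (integrable_absPow hr hm).congr (Filter.Eventually.of_forall fun x => ?_)
  simp only [ENNReal.toReal_ofReal (absPow_nonneg E p x), smul_eq_mul, absPow_add_smul hp hr]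

theorem isOpen_expSimplex (E : Finset (Fin n)) : IsOpen (expSimplex E) := by
  have : expSimplex E = (⋂ i ∈ E, {s : Fin n → ℝ | 0 < s i}) ∩ {s | ∑ i ∈ E, s i < 1} := by
    ext s; simp [expSimplex]
  rw [this]
  refine IsOpen.inter (isOpen_biInter_finset fun i _ => ?_) ?_
  · exact isOpen_lt continuous_const (continuous_apply i)
  · exact isOpen_lt (by fun_prop) continuous_const

theorem convex_expSimplex (E : Finset (Fin n)) : Convex ℝ (expSimplex E) := by
  intro s hs t ht a b ha hb hab
  refine ⟨fun i hi => ?_, ?_⟩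
  · have h1 := hs.1 i hi
    have h2 := ht.1 i hi
    simp only [Pi.add_apply, Pi.smul_apply, smul_eq_mul]
    rcases ha.eq_or_lt with rfl | ha
    · have : b = 1 := by linarith
      subst this; simpa using h2
    · exact add_pos_of_pos_of_nonneg (mul_pos ha h1) (mul_nonneg hb h2.le)
  · simp only [Pi.add_apply, Pi.smul_apply, smul_eq_mul, Finset.sum_add_distrib, ← Finset.mul_sum]
    have h1 := hs.2
    have h2 := ht.2
    rcases ha.eq_or_lt with rfl | ha
    · have : b = 1 := by linarith
      subst this; simpa using h2
    · nlinarith [mul_lt_mul_of_pos_left h1 ha, mul_le_mul_of_nonneg_left h2.le hb]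

theorem expSimplex_nonempty (E : Finset (Fin n)) : (expSimplex E).Nonempty := by
  refine ⟨fun _ => 1 / (E.card + 1), fun i _ => by positivity, ?_⟩
  rw [Finset.sum_const, nsmul_eq_mul, mul_one_div, div_lt_one (by positivity)]
  linarith

/-- The set of parameters for which a point on a line lies in the simplex. -/
def lineSet (E : Finset (Fin n)) (p d : Fin n → ℝ) : Set ℝ := {r | p + r • d ∈ expSimplex E}

theorem isOpen_lineSet (E : Finset (Fin n)) (p d : Fin n → ℝ) : IsOpen (lineSet E p d) :=
  (isOpen_expSimplex E).preimage (by fun_prop : Continuous fun r : ℝ => p + r • d)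

theorem isPreconnected_lineSet (E : Finset (Fin n)) (p d : Fin n → ℝ) :
    IsPreconnected (lineSet E p d) := by
  refine Convex.isPreconnected fun r hr s hs a b ha hb hab => ?_
  have := convex_expSimplex E hr hs ha hb hab
  have e : a • (p + r • d) + b • (p + s • d) = p + (a • r + b • s) • d := by
    rw [smul_add, smul_add, add_add_add_comm, ← add_smul, hab, one_smul, add_smul, smul_assoc,
      smul_assoc]
  rwa [e] at this

open ProbabilityTheory in
theorem analyticOnNhd_integral_absPow {E : Finset (Fin n)} {p d : Fin n → ℝ}
    (hp : p ∈ expSimplex E) {m : Measure (Rn n)} [IsFiniteMeasure m]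
    (hm : Integrable (fun x : Rn n => ‖x‖) m) :
    AnalyticOnNhd ℝ (fun r => ∫ x, absPow E (p + r • d) x ∂m) (lineSet E p d) := by
  have hsub : lineSet E p d ⊆ interior (integrableExpSet (logForm E d) (tilt E p m)) :=
    (isOpen_lineSet E p d).subset_interior_iff.2 fun r hr => integrable_exp_tilt hp hr hm
  refine (analyticOnNhd_mgf.mono hsub).congr (isOpen_lineSet E p d) fun r hr => ?_
  exact integral_exp_tilt hp hr m

/-! ### The Mellin transform and multiplicative convolution -/

/-- The Mellin transform of a signed measure. -/
def mellin (E : Finset (Fin n)) (σ : SignedMeasure (Rn n)) (s : Fin n → ℝ) : ℝ :=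
  ∫ x, absPow E s x ∂σ.toJordanDecomposition.posPart
    - ∫ x, absPow E s x ∂σ.toJordanDecomposition.negPart

theorem IsIntegrable.posPart {σ : SignedMeasure (Rn n)} (h : IsIntegrable σ) :
    Integrable (fun x : Rn n => ‖x‖) σ.toJordanDecomposition.posPart :=
  Integrable.mono_measure h (Measure.le_add_right le_rfl)

theorem IsIntegrable.negPart {σ : SignedMeasure (Rn n)} (h : IsIntegrable σ) :
    Integrable (fun x : Rn n => ‖x‖) σ.toJordanDecomposition.negPart :=
  Integrable.mono_measure h (Measure.le_add_left le_rfl)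

theorem analyticOnNhd_mellin {E : Finset (Fin n)} {p d : Fin n → ℝ} (hp : p ∈ expSimplex E)
    {σ : SignedMeasure (Rn n)} (hσ : IsIntegrable σ) :
    AnalyticOnNhd ℝ (fun r => mellin E σ (p + r • d)) (lineSet E p d) :=
  (analyticOnNhd_integral_absPow hp hσ.posPart).sub (analyticOnNhd_integral_absPow hp hσ.negPart)

/-- If the product of two Mellin transforms vanishes, so does one of them. -/
theorem mellin_eq_zero_of_mul {E : Finset (Fin n)} {σ τ : SignedMeasure (Rn n)}
    (hσ : IsIntegrable σ) (hτ : IsIntegrable τ)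
    (h : ∀ s ∈ expSimplex E, mellin E σ s * mellin E τ s = 0) {p : Fin n → ℝ}
    (hp : p ∈ expSimplex E) (hne : mellin E σ p ≠ 0) {q : Fin n → ℝ} (hq : q ∈ expSimplex E) :
    mellin E τ q = 0 := by
  have h0 : (0 : ℝ) ∈ lineSet E p (q - p) := by simpa [lineSet] using hp
  have h1 : (1 : ℝ) ∈ lineSet E p (q - p) := by simpa [lineSet] using hq
  have haσ := analyticOnNhd_mellin (d := q - p) hp hσ
  have haτ := analyticOnNhd_mellin (d := q - p) hp hτ
  -- On the segment from `p` (`r = 0`) to `q` (`r = 1`), the first factor stays nonzero near `r =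
  -- 0`, so the second vanishes there and hence, by analyticity, at `r = 1`.
  have hev : (fun r : ℝ => mellin E τ (p + r • (q - p))) =ᶠ[nhds 0] 0 := by
    have hc : ∀ᶠ r in nhds (0 : ℝ), mellin E σ (p + r • (q - p)) ≠ 0 :=
      (haσ 0 h0).continuousAt.eventually_ne (by simpa using hne)
    filter_upwards [hc, (isOpen_lineSet E p (q - p)).mem_nhds h0] with r hr hr'
    exact (mul_eq_zero.1 (h _ hr')).resolve_left hr
  have := haτ.eqOn_zero_of_preconnected_of_eventuallyEq_zero
    (isPreconnected_lineSet E p (q - p)) h0 hev h1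
  simpa using this

theorem apply_eq_posPart_sub_negPart {α : Type*} [MeasurableSpace α] (σ : SignedMeasure α)
    {A : Set α} (hA : MeasurableSet A) : σ A = σ.toJordanDecomposition.posPart.real A
      - σ.toJordanDecomposition.negPart.real A :=
  SignedMeasure.apply_eq_posPart_real_sub_negPart_real σ hA

theorem prod_toSignedMeasure (ν μ : SignedMeasure (Rn n)) :
    ν.prod μ (ContinuousLinearMap.lsmul ℝ ℝ) =
      (ν.toJordanDecomposition.posPart.prod μ.toJordanDecomposition.posPart).toSignedMeasure
      + (ν.toJordanDecomposition.negPart.prod μ.toJordanDecomposition.negPart).toSignedMeasure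
      - (ν.toJordanDecomposition.posPart.prod μ.toJordanDecomposition.negPart).toSignedMeasure
      - (ν.toJordanDecomposition.negPart.prod μ.toJordanDecomposition.posPart).toSignedMeasure := by
  refine VectorMeasure.prod_eq_of_forall_apply_prod fun A C hA hC => ?_
  simp only [sub_apply, add_apply,
    Measure.toSignedMeasure_apply_measurable (hA.prod hC), measureReal_prod_prod,
    ContinuousLinearMap.lsmul_apply, smul_eq_mul, apply_eq_posPart_sub_negPart ν hA,
    apply_eq_posPart_sub_negPart μ hC]
  ring

theorem integral_absPow_prod (E : Finset (Fin n)) (s : Fin n → ℝ) (a b : Measure (Rn n))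
    [IsFiniteMeasure a] [IsFiniteMeasure b] :
    ∫ z, absPow E s z ∂((a.prod b).map fun p => cmul p.1 p.2)
      = (∫ x, absPow E s x ∂a) * ∫ y, absPow E s y ∂b := by
  rw [integral_map measurable_cmul.aemeasurable (measurable_absPow E s).aestronglyMeasurable,
    ← integral_prod_mul]
  simp only [absPow_cmul]

theorem mellin_mul_eq_zero {E : Finset (Fin n)} {ν μ : SignedMeasure (Rn n)}
    (hν : IsIntegrable ν) (hμ : IsIntegrable μ) (h : mconv ν μ = 0) {s : Fin n → ℝ}
    (hs : s ∈ expSimplex E) : mellin E ν s * mellin E μ s = 0 := by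
  set a := ν.toJordanDecomposition.posPart with ha
  set b := ν.toJordanDecomposition.negPart with hb
  set c := μ.toJordanDecomposition.posPart with hc
  set d := μ.toJordanDecomposition.negPart with hd
  -- With the negative terms moved across, a vanishing signed convolution becomes an equality of
  -- positive measures, against which `absPow` can be integrated.
  have hmeas : ((a.prod c).map fun p => cmul p.1 p.2) + ((b.prod d).map fun p => cmul p.1 p.2)
      = ((a.prod d).map fun p => cmul p.1 p.2) + ((b.prod c).map fun p => cmul p.1 p.2) := by
    ext B hB
    have hm := measurable_cmul hB
    have h1 : mconv ν μ B = 0 := by rw [h]; rfl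
    rw [mconv, prod_toSignedMeasure, VectorMeasure.map_apply _ measurable_cmul hB] at h1
    simp only [sub_apply, add_apply,
      Measure.toSignedMeasure_apply_measurable hm, ← ha, ← hb, ← hc, ← hd] at h1
    simp only [Measure.add_apply, Measure.map_apply measurable_cmul hB]
    rw [← ENNReal.toReal_eq_toReal_iff' (by finiteness) (by finiteness),
      ENNReal.toReal_add (by finiteness) (by finiteness),
      ENNReal.toReal_add (by finiteness) (by finiteness)]
    simp only [measureReal_def] at h1
    linarith
  have hint : ∀ (a b : Measure (Rn n)) [IsFiniteMeasure a] [IsFiniteMeasure b],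
      Integrable (fun x : Rn n => ‖x‖) a → Integrable (fun x : Rn n => ‖x‖) b →
      Integrable (absPow E s) ((a.prod b).map fun p => cmul p.1 p.2) := by
    intro a b _ _ h1 h2
    rw [integrable_map_measure (measurable_absPow E s).aestronglyMeasurable
      measurable_cmul.aemeasurable]
    refine ((integrable_absPow hs h1).mul_prod (integrable_absPow hs h2)).congr
      (Filter.Eventually.of_forall fun p => ?_)
    simp only [Function.comp, absPow_cmul]
  have h2 := congrArg (fun m => ∫ z, absPow E s z ∂m) hmeas
  rw [integral_add_measure (hint _ _ hν.posPart hμ.posPart) (hint _ _ hν.negPart hμ.negPart),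
    integral_add_measure (hint _ _ hν.posPart hμ.negPart) (hint _ _ hν.negPart hμ.posPart),
    integral_absPow_prod, integral_absPow_prod, integral_absPow_prod, integral_absPow_prod] at h2
  simp only [mellin, ← ha, ← hb, ← hc, ← hd]
  linarith

/-! ### Injectivity of the Mellin transform up to signs -/

/-- The coordinatewise logarithm of the absolute value on the coordinates in `E`. -/
def logVec (E : Finset (Fin n)) (x : Rn n) : Rn n :=
  WithLp.toLp 2 fun i => if i ∈ E then Real.log |x i| else 0

theorem measurable_logVec (E : Finset (Fin n)) : Measurable (logVec E) := by
  refine (WithLp.measurable_toLp 2 (Fin n → ℝ)).comp (measurable_pi_lambda _ fun i => ?_)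
  by_cases h : i ∈ E <;> simp only [h, if_true, if_false]
  · exact Real.measurable_log.comp (measurable_coord_abs i)
  · exact measurable_const

theorem inner_logVec (E : Finset (Fin n)) (x t : Rn n) :
    inner ℝ (logVec E x) t = logForm E (fun i => t i) x := by
  simp [PiLp.inner_apply, logVec, logForm, Finset.sum_ite_mem]

/-- Undoes the tilt after passing to the image: on `offAxes E` the density is a function of `logVec
E` alone, so its reciprocal is too. -/
theorem measure_offAxes_inter {E : Finset (Fin n)} {p : Fin n → ℝ} (hp : p ∈ expSimplex E)
    (m : Measure (Rn n)) {B : Set (Rn n)} (hB : MeasurableSet B) :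
    m (offAxes E ∩ logVec E ⁻¹' B) =
      ∫⁻ y in B, ENNReal.ofReal (Real.exp (-inner ℝ y (WithLp.toLp 2 p)))
        ∂((tilt E p m).map (logVec E)) := by
  have hL := measurable_logVec E
  have hw : Measurable fun x : Rn n =>
      ENNReal.ofReal (Real.exp (-inner ℝ (logVec E x) (WithLp.toLp 2 p))) := by fun_prop
  have hpt : ∀ x : Rn n, ENNReal.ofReal (absPow E p x) *
      ENNReal.ofReal (Real.exp (-inner ℝ (logVec E x) (WithLp.toLp 2 p)))
      = (offAxes E).indicator 1 x := by
    intro x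
    by_cases hx : x ∈ offAxes E
    · rw [Set.indicator_of_mem hx, inner_logVec, absPow_eq_exp p hx,
        ← ENNReal.ofReal_mul (Real.exp_pos _).le, ← Real.exp_add, add_neg_cancel]
      simp
    · rw [Set.indicator_of_notMem hx, absPow_eq_zero hp hx]
      simp
  rw [setLIntegral_map hB (by fun_prop) hL, tilt,
    setLIntegral_withDensity_eq_setLIntegral_mul _ (measurable_absPow E p).ennreal_ofReal
      hw (hL hB)]
  simp only [Pi.mul_apply, hpt]
  rw [lintegral_indicator_one (measurableSet_offAxes E),
    Measure.restrict_apply (measurableSet_offAxes E)]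

/-- A signed measure with vanishing Mellin transform vanishes on the sets which are measurable with
respect to the logarithms of the absolute values of the coordinates. -/
theorem apply_offAxes_inter_eq_zero {E : Finset (Fin n)} {σ : SignedMeasure (Rn n)}
    (hσ : IsIntegrable σ) (h : ∀ s ∈ expSimplex E, mellin E σ s = 0) {B : Set (Rn n)}
    (hB : MeasurableSet B) : σ (offAxes E ∩ logVec E ⁻¹' B) = 0 := by
  obtain ⟨p, hp⟩ := expSimplex_nonempty E
  have hf1 := isFiniteMeasure_tilt hp hσ.posPart
  have hf2 := isFiniteMeasure_tilt hp hσ.negPart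
  have hmap : (tilt E p σ.toJordanDecomposition.posPart).map (logVec E)
      = (tilt E p σ.toJordanDecomposition.negPart).map (logVec E) := by
    refine map_eq_of_exp_moments (measurable_logVec E) fun t => ?_
    refine ⟨lineSet E p fun i => t i, (isOpen_lineSet E p _).mem_nhds ?_, fun r hr => ?_⟩
    · simpa [lineSet] using hp
    · simp only [inner_logVec]
      refine ⟨integrable_exp_tilt hp hr hσ.posPart, integrable_exp_tilt hp hr hσ.negPart, ?_⟩
      rw [integral_exp_tilt hp hr, integral_exp_tilt hp hr]
      exact sub_eq_zero.1 (h _ hr)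
  rw [apply_eq_posPart_sub_negPart σ
    ((measurableSet_offAxes E).inter (measurable_logVec E hB)), measureReal_def, measureReal_def,
    measure_offAxes_inter hp _ hB, measure_offAxes_inter hp _ hB, hmap, sub_self]

/-- The coordinatewise exponential. -/
def expVec (y : Rn n) : Rn n := WithLp.toLp 2 fun i => Real.exp (y i)

@[simp] theorem expVec_apply (y : Rn n) (i : Fin n) : expVec y i = Real.exp (y i) := rfl

theorem measurable_expVec : Measurable (expVec (n := n)) := by
  unfold expVec; fun_prop

theorem component_marginal_uncMean_eq_zero {E : Finset (Fin n)} {σ : SignedMeasure (Rn n)}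
    (hσ : IsIntegrable σ) (h : ∀ s ∈ expSimplex E, mellin E σ s = 0) :
    component E (marginal E (uncMean σ)) = 0 := by
  rw [component_marginal_eq_zero_iff]
  intro B hB
  have hC := hB.inter (measurableSet_stratum E)
  have hPC := measurable_coordProj E hC
  rw [uncMean_apply σ hPC, sum_reflect_eq_sum_reflect_absVec σ hPC, Finset.sum_eq_zero, mul_zero]
  intro F _
  -- Averaging needs only the moduli, and the moduli of the coordinates in `E` are exponentials of
  -- their logarithms, so the set is measurable with respect to `logVec E`.
  have hset : absVec ⁻¹' (reflect F ⁻¹' (coordProj E ⁻¹' (B ∩ stratum E))) = offAxes E ∩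
      logVec E ⁻¹' (expVec ⁻¹' (reflect F ⁻¹' (coordProj E ⁻¹' (B ∩ stratum E)))) := by
    ext x
    have hx : x ∈ offAxes E →
        coordProj E (reflect F (absVec x)) = coordProj E (reflect F (expVec (logVec E x))) := by
      intro hx
      ext i
      by_cases hi : i ∈ E
      · have := Real.exp_log (abs_pos.2 (hx i hi))
        rw [Real.log_abs] at this
        simp [hi, logVec, this]
      · simp [hi]
    constructor
    · intro hmem
      have h1 : x ∈ offAxes E := by
        intro i hi h0
        have := (hmem.2 i).2 hi
        simp [hi, h0] at this
      refine ⟨h1, ?_⟩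
      simp only [Set.mem_preimage] at hmem ⊢
      rwa [← hx h1]
    · rintro ⟨h1, hmem⟩
      simp only [Set.mem_preimage] at hmem ⊢
      rwa [hx h1]
  rw [hset]
  exact apply_offAxes_inter_eq_zero hσ h (measurable_expVec (measurable_reflect F hPC))

theorem component_marginal_eq_zero_of_mconv {E : Finset (Fin n)} {ν μ : SignedMeasure (Rn n)}
    (hν : IsIntegrable ν) (hμ : IsIntegrable μ) (hunc : IsUnconditional μ)
    (hne : component E (marginal E (uncMean ν)) ≠ 0) (h : mconv ν μ = 0) :
    component E (marginal E μ) = 0 := by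
  have h1 : ∃ p ∈ expSimplex E, mellin E ν p ≠ 0 := by
    by_contra! hall
    exact hne (component_marginal_uncMean_eq_zero hν hall)
  obtain ⟨p, hp, hnep⟩ := h1
  rw [← hunc.uncMean_eq]
  exact component_marginal_uncMean_eq_zero hμ fun q hq =>
    mellin_eq_zero_of_mul hν hμ (fun s hs => mellin_mul_eq_zero hν hμ h hs) hp hnep hq

/-! ### The four criteria -/

theorem hasDegree_iff (σ : SignedMeasure (Rn n)) :
    HasDegree σ n ↔ component Finset.univ σ ≠ 0 := by
  constructor
  · rintro ⟨⟨E, hE, hne⟩, -⟩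
    rwa [← (Finset.card_eq_iff_eq_univ E).1 (by simpa using hE)]
  · refine fun h => ⟨⟨Finset.univ, by simp, h⟩, ?_⟩
    rintro m ⟨E, rfl, -⟩
    simpa using Finset.card_le_univ E

theorem isUniversalOn_stratum_univ_iff {ν : SignedMeasure (Rn n)} (hν : IsIntegrable ν) :
    IsUniversalOn ν (intUnc (stratum Finset.univ)) ↔ component Finset.univ (uncMean ν) ≠ 0 := by
  constructor
  · intro h h0
    refine cornerMeasure_ne_zero (n := n) Finset.univ (h _
      ⟨concentratedOn_cornerMeasure _, isIntegrable_cornerMeasure _,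
        isUnconditional_cornerMeasure _⟩ (mconv_cornerMeasure_eq_zero ?_))
    rwa [marginal_univ]
  · rintro h μ ⟨hc, hμ, hunc⟩ h0
    have h1 := component_marginal_eq_zero_of_mconv (E := Finset.univ) hν hμ hunc
      (by rwa [marginal_univ]) h0
    rw [marginal_univ, component_eq_zero_iff] at h1
    ext B hB
    have hm := measurableSet_stratum (n := n) Finset.univ
    rw [← Set.inter_union_sdiff B (stratum Finset.univ), VectorMeasure.of_union
      Set.disjoint_sdiff_inter.symm (hB.inter hm) (hB.diff hm), h1 B hB,
      hc _ (hB.diff hm) fun x hx => hx.2]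
    simp

theorem isUniversalOn_univ_iff {ν : SignedMeasure (Rn n)} (hν : IsIntegrable ν) :
    IsUniversalOn ν (intUnc Set.univ) ↔
      ∀ E : Finset (Fin n), component E (marginal E (uncMean ν)) ≠ 0 := by
  constructor
  · intro h E h0
    refine cornerMeasure_ne_zero E (h _ ⟨fun B _ hBE => ?_, isIntegrable_cornerMeasure _,
      isUnconditional_cornerMeasure _⟩ (mconv_cornerMeasure_eq_zero h0))
    rw [Set.compl_univ, Set.subset_empty_iff] at hBE
    rw [hBE, VectorMeasure.empty]
  · rintro h μ ⟨-, hμ, hunc⟩ h0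
    exact eq_zero_of_component_marginal fun E =>
      component_marginal_eq_zero_of_mconv hν hμ hunc (h E) h0

/-- The number `ν (offAxes E)` is the total mass of the component, since `offAxes E` is invariant
under reflections. -/
theorem component_marginal_uncMean_ne_zero {E : Finset (Fin n)} {ν : SignedMeasure (Rn n)}
    (h : ν (offAxes E) ≠ 0) : component E (marginal E (uncMean ν)) ≠ 0 := by
  intro h0
  have h1 := (component_marginal_eq_zero_iff E _).1 h0 Set.univ MeasurableSet.univ
  rw [Set.univ_inter, coordProj_preimage_stratum,
    uncMean_apply_of_invariant ν (measurableSet_offAxes E) (reflect_preimage_offAxes E)] at h1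
  exact h h1

theorem stratum_univ_subset_offAxes (E : Finset (Fin n)) :
    stratum Finset.univ ⊆ offAxes E := fun _ hx i _ => (hx i).2 (Finset.mem_univ i)

/-- The projection for `E = ∅` is constant, so the marginal is `ν(ℝⁿ) δ₀`. -/
theorem component_marginal_empty_eq_zero {ν : SignedMeasure (Rn n)} (h : ν Set.univ = 0) :
    component ∅ (marginal ∅ (uncMean ν)) = 0 := by
  rw [component_marginal_eq_zero_iff]
  intro B _
  have hconst : coordProj (∅ : Finset (Fin n)) = fun _ => 0 := by ext x i; simp
  rw [hconst]
  by_cases hB : (0 : Rn n) ∈ B ∩ stratum ∅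
  · rw [Set.preimage_const_of_mem hB, uncMean_apply_of_invariant ν MeasurableSet.univ
      fun _ => Set.preimage_univ, h]
  · rw [Set.preimage_const_of_notMem hB, VectorMeasure.empty]

theorem IsOfOrder.apply_eq {ν : SignedMeasure (Rn n)} {E : Finset (Fin n)} (h : IsOfOrder ν E)
    {B : Set (Rn n)} (hB : MeasurableSet B) : ν B = ν (B ∩ stratum E) := by
  rw [apply_eq_sum_stratum ν hB, Finset.sum_eq_single E]
  · intro F _ hFE
    exact SignedMeasure.null_of_totalVariation_zero ν
      (measure_mono_null Set.inter_subset_right (h.2 F hFE))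
  · simp

theorem IsOfOrder.isUniversalOn_iff {ν : SignedMeasure (Rn n)} (hν : IsIntegrable ν)
    (h : IsOfOrder ν Finset.univ) :
    IsUniversalOn ν (intUnc Set.univ) ↔ ν Set.univ ≠ 0 := by
  rw [isUniversalOn_univ_iff hν]
  refine ⟨fun h1 h0 => h1 ∅ (component_marginal_empty_eq_zero h0), fun h1 E => ?_⟩
  refine component_marginal_uncMean_ne_zero ?_
  -- Every `offAxes E` contains the stratum carrying `ν`, so its mass is `ν(ℝⁿ)`.
  rwa [h.apply_eq (measurableSet_offAxes E),
    Set.inter_eq_right.2 (stratum_univ_subset_offAxes E), ← Set.univ_inter (stratum Finset.univ),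
    ← h.apply_eq MeasurableSet.univ]

theorem isUniversalOn_iff_of_nonneg {ν : SignedMeasure (Rn n)} (hν : IsIntegrable ν)
    (h : 0 ≤ ν) : IsUniversalOn ν (intUnc Set.univ) ↔ component Finset.univ ν ≠ 0 := by
  rw [isUniversalOn_univ_iff hν]
  have hm := measurableSet_stratum (n := n) Finset.univ
  constructor
  · intro h1 h0
    refine h1 Finset.univ ?_
    rw [marginal_univ, component_eq_zero_iff]
    intro B hB
    rw [uncMean_apply ν (hB.inter hm), Finset.sum_eq_zero, mul_zero]
    intro F _
    rw [Set.preimage_inter, reflect_preimage_stratum]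
    exact (component_eq_zero_iff _ ν).1 h0 _ (measurable_reflect F hB)
  · intro h1 E
    refine component_marginal_uncMean_ne_zero fun h0 => h1 ?_
    rw [component_eq_zero_iff]
    intro B hB
    have hsub : B ∩ stratum Finset.univ ⊆ offAxes E :=
      Set.inter_subset_right.trans (stratum_univ_subset_offAxes E)
    -- Non-negativity rules out cancellation: zero mass on `offAxes E` forces zero mass on each of
    -- its Borel subsets, in particular inside the open stratum.
    have hadd := VectorMeasure.of_add_of_sdiff (v := ν) (hB.inter hm) (measurableSet_offAxes E) hsub
    have h2 : 0 ≤ ν (B ∩ stratum Finset.univ) := VectorMeasure.le_iff'.1 h _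
    have h3 : 0 ≤ ν (offAxes E \ (B ∩ stratum Finset.univ)) := VectorMeasure.le_iff'.1 h _
    linarith

end
end MultConv

open MultConv in
theorem mainTheorem9 (n : ℕ) (hn : 1 ≤ n) (ν : SignedMeasure (Rn n)) (hν : IsIntegrable ν) :
    (IsUniversalOn ν (intUnc (stratum Finset.univ)) ↔ HasDegree (uncMean ν) n) ∧
    (IsUniversalOn ν (intUnc Set.univ) ↔
      ∀ E : Finset (Fin n), component E (marginal E (uncMean ν)) ≠ 0) ∧
    (IsOfOrder ν Finset.univ → (IsUniversalOn ν (intUnc Set.univ) ↔ ν Set.univ ≠ 0)) ∧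
    (0 ≤ ν → (IsUniversalOn ν (intUnc Set.univ) ↔ HasDegree ν n)) := by
  refine ⟨?_, isUniversalOn_univ_iff hν, fun h => h.isUniversalOn_iff hν, fun h => ?_⟩
  · rw [hasDegree_iff, isUniversalOn_stratum_univ_iff hν]
  · rw [hasDegree_iff, isUniversalOn_iff_of_nonneg hν h]
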